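/- Let $d\ge 2$. **Notation.** For $u\in L^1(\mathbb R^d)$ put $\|Du\|(\mathbb R^d)=\sup\{\int u\,\operatorname{div} v : v\in C^1_c(\mathbb R^d;\mathbb R^d),\ |v|\le 1\}$. Let $BV([0,1]^d)$ be the space of (classes of) functions $u\in L^1(\mathbb R^d)$ that vanish a.e. outside $[0,1]^d$ and satisfy $\|Du\|(\mathbb R^d)<\infty$, with the norm $\|u\|_{BV}=\|u\|_1+\|Du\|(\mathbb R^d)$. Let $SCH([0,1]^d)$ be the closure in the dual space $BV([0,1]^d)^*$ (for the operator norm) of the set of functionals $T_g\colon u\mapsto\int_{[0,1]^d} g\,u$ with $g\in L^d([0,1]^d)$. A $BV$-subset of $[0,1]^d$ is a measurable set $B\subset[0,1]^d$ with $\|D\mathbf 1_B\|(\mathbb R^d)<\infty$; a strong charge is a function on the $BV$-subsets of $[0,1]^d$ of the form $B\mapsto\alpha(\mathbf 1_B)$ with $\alpha\in SCH([0,1]^d)$. Let $C_0([0,1]^d)$ be the set of continuous functions on $[0,1]^d$ that vanish at every point having at least one zero coordinate. For $f\in C_0([0,1]^d)$ and a rectangle $K=\prod_{i=1}^d[a_i,b_i]\subset[0,1]^d$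 with $a_i<b_i$, let $$\Delta_f(K)=\sum_{c\in\prod_i\{a_i,b_i\}}(-1)^{\#\{i\,:\,c_i=a_i\}}f(c),$$ and extend $\Delta_f$ by finite additivity to figures, i.e. to finite unions of rectangles: $\Delta_f(K_1\cup\dots\cup K_n)=\sum_j\Delta_f(K_j)$ for pairwise almost disjoint rectangles $K_1,\dots,K_n$. The function $f$ is called *strongly chargeable* if $\Delta_f$ extends from figures to a strong charge. **Theorem.** Let $W=(W_t)_{t\in[0,1]^d}$ be a standard Brownian sheet on a probability space, that is, a centered Gaussian process with covariance $\mathbb E(W_sW_t)=\prod_{i=1}^d\min(s_i,t_i)$, all of whose sample paths $t\mapsto W_t(\omega)$ belong to $C_0([0,1]^d)$. Then, almost surely, the sample path of $W$ is not strongly chargeable. -/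

import Mathlib

open MeasureTheory ProbabilityTheory
open scoped ENNReal

noncomputable section

namespace BrownianSheet

/-- `ℝ^d` with its Euclidean norm and Lebesgue measure. -/
abbrev Eucl (d : ℕ) : Type := EuclideanSpace ℝ (Fin d)

/-- The closed unit cube `[0,1]^d` as a subset of `ℝ^d`. -/
def cube (d : ℕ) : Set (Eucl d) := {x | ∀ i, 0 ≤ x i ∧ x i ≤ 1}

/-! ### Functions of bounded variation -/

/-- The divergence of a vector field, `∑ i, ∂ᵢ vᵢ`. -/
def diverg {d : ℕ} (v : Eucl d → Eucl d) (x : Eucl d) : ℝ :=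
  ∑ i, (fderiv ℝ v x (EuclideanSpace.single i 1)) i

/-- The vector fields in `C¹_c(ℝ^d; ℝ^d)` with `|v| ≤ 1` everywhere. -/
def testFields (d : ℕ) : Set (Eucl d → Eucl d) :=
  {v | ContDiff ℝ 1 v ∧ HasCompactSupport v ∧ ∀ x, ‖v x‖ ≤ 1}

/-- The variation `‖Du‖(ℝ^d) = sup {∫ u div v : v ∈ C¹_c(ℝ^d; ℝ^d), |v| ≤ 1} ∈ [0,∞]` of an integrable
function `u` on `ℝ^d`. (The supremum is nonnegative because `v = 0` is allowed.) -/
def variation {d : ℕ} (u : Eucl d → ℝ) : ℝ≥0∞ :=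
  ⨆ v ∈ testFields d, ENNReal.ofReal (∫ x, u x * diverg v x)

lemma continuous_diverg {d : ℕ} {v : Eucl d → Eucl d} (hv : v ∈ testFields d) :
    Continuous (diverg v) := by
  have h : Continuous (fderiv ℝ v) := hv.1.continuous_fderiv (by norm_num)
  unfold diverg
  fun_prop

lemma hasCompactSupport_diverg {d : ℕ} {v : Eucl d → Eucl d} (hv : v ∈ testFields d) :
    HasCompactSupport (diverg v) := by
  have h : HasCompactSupport (fderiv ℝ v) := hv.2.1.fderiv ℝ
  refine h.comp_left (g := fun L : Eucl d →L[ℝ] Eucl d =>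
    ∑ i, (L (EuclideanSpace.single i 1)) i) ?_
  simp

lemma integrable_mul_diverg {d : ℕ} {u : Eucl d → ℝ} (hu : Integrable u)
    {v : Eucl d → Eucl d} (hv : v ∈ testFields d) :
    Integrable (fun x => u x * diverg v x) := by
  obtain ⟨C, hC⟩ := (continuous_diverg hv).bounded_above_of_compact_support
    (hasCompactSupport_diverg hv)
  exact hu.mul_bdd (c := C) (continuous_diverg hv).aestronglyMeasurable (.of_forall hC)

lemma neg_mem_testFields {d : ℕ} {v : Eucl d → Eucl d} (hv : v ∈ testFields d) :
    -v ∈ testFields d :=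
  ⟨hv.1.neg, hv.2.1.neg, fun x => by simpa using hv.2.2 x⟩

lemma diverg_neg {d : ℕ} (v : Eucl d → Eucl d) (x : Eucl d) :
    diverg (-v) x = -diverg v x := by
  simp [diverg, fderiv_neg]

lemma variation_congr {d : ℕ} {u w : Eucl d → ℝ} (h : u =ᵐ[volume] w) :
    variation u = variation w := by
  unfold variation
  refine iSup_congr fun v => iSup_congr fun _ => ?_
  congr 1
  apply integral_congr_ae
  filter_upwards [h] with x hx
  rw [hx]

lemma variation_zero {d : ℕ} : variation (fun _ : Eucl d => (0 : ℝ)) = 0 := by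
  simp [variation]

lemma variation_add_le {d : ℕ} {u w : Eucl d → ℝ} (hu : Integrable u) (hw : Integrable w) :
    variation (fun x => u x + w x) ≤ variation u + variation w := by
  refine iSup₂_le fun v hv => ?_
  simp only [add_mul]
  rw [integral_add (integrable_mul_diverg hu hv) (integrable_mul_diverg hw hv)]
  refine ENNReal.ofReal_add_le.trans (add_le_add ?_ ?_)
  · exact le_iSup₂ (f := fun v (_ : v ∈ testFields d) =>
      ENNReal.ofReal (∫ x, u x * diverg v x)) v hv
  · exact le_iSup₂ (f := fun v (_ : v ∈ testFields d) =>
      ENNReal.ofReal (∫ x, w x * diverg v x)) v hv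

lemma variation_smul_le {d : ℕ} (c : ℝ) (u : Eucl d → ℝ) :
    variation (fun x => c * u x) ≤ ENNReal.ofReal |c| * variation u := by
  refine iSup₂_le fun v hv => ?_
  simp only [mul_assoc]
  rw [integral_const_mul]
  rcases le_total 0 c with hc | hc
  · rw [ENNReal.ofReal_mul hc, abs_of_nonneg hc]
    gcongr
    exact le_iSup₂ (f := fun v (_ : v ∈ testFields d) =>
      ENNReal.ofReal (∫ x, u x * diverg v x)) v hv
  · have h1 : c * ∫ x, u x * diverg v x = |c| * ∫ x, u x * diverg (-v) x := by
      simp only [diverg_neg, mul_neg, integral_neg, abs_of_nonpos hc]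
      ring
    rw [h1, ENNReal.ofReal_mul (abs_nonneg c)]
    gcongr
    exact le_iSup₂ (f := fun v (_ : v ∈ testFields d) =>
      ENNReal.ofReal (∫ x, u x * diverg v x)) (-v) (neg_mem_testFields hv)

/-- The linear space underlying `BV([0,1]^d)`: the classes `u ∈ L¹(ℝ^d)` that vanish almost
everywhere outside `[0,1]^d` and have `‖Du‖(ℝ^d) < ∞`. -/
def bvSubmodule (d : ℕ) : Submodule ℝ (Lp ℝ 1 (volume : Measure (Eucl d))) where
  carrier := {u | (∀ᵐ x, x ∉ cube d → u x = 0) ∧ variation u < ⊤}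
  zero_mem' := by
    have h : (⇑(0 : Lp ℝ 1 (volume : Measure (Eucl d)))) =ᵐ[volume] fun _ => (0 : ℝ) :=
      Lp.coeFn_zero ℝ 1 volume
    refine ⟨?_, ?_⟩
    · filter_upwards [h] with x hx _ using hx
    · rw [variation_congr h, variation_zero]
      exact ENNReal.zero_lt_top
  add_mem' := by
    intro u w hu hw
    have h : ⇑(u + w) =ᵐ[volume] fun x => u x + w x := Lp.coeFn_add u w
    refine ⟨?_, ?_⟩
    · filter_upwards [h, hu.1, hw.1] with x hx h1 h2 h3
      rw [hx, h1 h3, h2 h3, add_zero]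
    · rw [variation_congr h]
      exact (variation_add_le (L1.integrable_coeFn u) (L1.integrable_coeFn w)).trans_lt
        (ENNReal.add_lt_top.2 ⟨hu.2, hw.2⟩)
  smul_mem' := by
    intro c u hu
    have h : ⇑(c • u) =ᵐ[volume] fun x => c * u x := Lp.coeFn_smul c u
    refine ⟨?_, ?_⟩
    · filter_upwards [h, hu.1] with x hx h1 h3
      rw [hx, h1 h3, mul_zero]
    · rw [variation_congr h]
      exact (variation_smul_le c u).trans_lt (ENNReal.mul_lt_top ENNReal.ofReal_lt_top hu.2)

/-- The space `BV([0,1]^d)`. It is a type of its own (not a subspace of `L¹`), since it carries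
the `BV` norm and not the `L¹` norm. -/
def BV (d : ℕ) : Type := bvSubmodule d

namespace BV

variable {d : ℕ}

instance : AddCommGroup (BV d) := inferInstanceAs (AddCommGroup (bvSubmodule d))

instance : Module ℝ (BV d) := inferInstanceAs (Module ℝ (bvSubmodule d))

/-- The class in `L¹(ℝ^d)` of a function of bounded variation. -/
def toL1 (u : BV d) : Lp ℝ 1 (volume : Measure (Eucl d)) := Subtype.val u

lemma toL1_add (u w : BV d) : (u + w).toL1 = u.toL1 + w.toL1 := rfl

lemma toL1_smul (c : ℝ) (u : BV d) : (c • u).toL1 = c • u.toL1 := rfl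

lemma toL1_zero : (0 : BV d).toL1 = 0 := rfl

lemma toL1_injective : Function.Injective (toL1 : BV d → _) := Subtype.val_injective

lemma variation_lt_top (u : BV d) : variation u.toL1 < ⊤ := u.2.2

/-- The norm `‖u‖_BV = ‖u‖₁ + ‖Du‖(ℝ^d)`. -/
instance : Norm (BV d) := ⟨fun u => ‖u.toL1‖ + (variation u.toL1).toReal⟩

lemma norm_def (u : BV d) : ‖u‖ = ‖u.toL1‖ + (variation u.toL1).toReal := rfl

lemma variation_smul_toReal_le (c : ℝ) (u : BV d) :
    (variation (c • u).toL1).toReal ≤ |c| * (variation u.toL1).toReal := by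
  have h : ⇑(c • u).toL1 =ᵐ[volume] fun x => c * u.toL1 x := Lp.coeFn_smul c u.toL1
  rw [variation_congr h]
  have h2 := ENNReal.toReal_mono (ENNReal.mul_lt_top ENNReal.ofReal_lt_top
    (variation_lt_top u)).ne (variation_smul_le c u.toL1)
  rwa [ENNReal.toReal_mul, ENNReal.toReal_ofReal (abs_nonneg c)] at h2

lemma variation_smul_toReal (c : ℝ) (u : BV d) :
    (variation (c • u).toL1).toReal = |c| * (variation u.toL1).toReal := by
  refine le_antisymm (variation_smul_toReal_le c u) ?_
  rcases eq_or_ne c 0 with rfl | hc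
  · simp
  · have h := variation_smul_toReal_le c⁻¹ (c • u)
    rw [smul_smul, inv_mul_cancel₀ hc, one_smul, abs_inv] at h
    have hc' : 0 < |c| := abs_pos.2 hc
    calc |c| * (variation u.toL1).toReal
        ≤ |c| * (|c|⁻¹ * (variation (c • u).toL1).toReal) := by gcongr
      _ = (variation (c • u).toL1).toReal := by field_simp

lemma variation_add_toReal_le (u w : BV d) :
    (variation (u + w).toL1).toReal ≤ (variation u.toL1).toReal + (variation w.toL1).toReal := by
  have h : ⇑(u + w).toL1 =ᵐ[volume] fun x => u.toL1 x + w.toL1 x :=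
    Lp.coeFn_add u.toL1 w.toL1
  rw [variation_congr h, ← ENNReal.toReal_add (variation_lt_top u).ne (variation_lt_top w).ne]
  exact ENNReal.toReal_mono (ENNReal.add_lt_top.2 ⟨variation_lt_top u, variation_lt_top w⟩).ne
    (variation_add_le (L1.integrable_coeFn _) (L1.integrable_coeFn _))

lemma core : NormedSpace.Core ℝ (BV d) where
  norm_nonneg u := add_nonneg (norm_nonneg _) ENNReal.toReal_nonneg
  norm_smul c u := by
    rw [norm_def, norm_def, variation_smul_toReal, toL1_smul, norm_smul, Real.norm_eq_abs]
    ring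
  norm_triangle u w := by
    have h1 := norm_add_le u.toL1 w.toL1
    have h2 := variation_add_toReal_le u w
    rw [norm_def, norm_def, norm_def, toL1_add]
    rw [toL1_add] at h2
    linarith
  norm_eq_zero_iff u := by
    constructor
    · intro h
      have h1 : 0 ≤ (variation u.toL1).toReal := ENNReal.toReal_nonneg
      have h2 := norm_nonneg u.toL1
      rw [norm_def] at h
      have h3 : ‖u.toL1‖ = 0 := by linarith
      exact toL1_injective (norm_eq_zero.1 h3)
    · rintro rfl
      rw [norm_def, toL1_zero, variation_congr (Lp.coeFn_zero ℝ 1 volume)]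
      have h : variation (0 : Eucl d → ℝ) = 0 := variation_zero
      simp [h]

instance : NormedAddCommGroup (BV d) := NormedAddCommGroup.ofCore core

instance : NormedSpace ℝ (BV d) := NormedSpace.ofCore core

end BV

/-! ### Strong charge functionals -/

/-- The range of `T : L^d([0,1]^d) → BV([0,1]^d)^*`, `T_f(u) = ∫_{[0,1]^d} f u`.
(`f u` is integrable, and `T_f` is continuous, by the Sobolev inequality
`BV([0,1]^d) ⊆ L^{d/(d-1)}`; so each `f ∈ L^d([0,1]^d)` gives one element.) -/
def rangeT (d : ℕ) : Set (BV d →L[ℝ] ℝ) :=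
  {α | ∃ f : Eucl d → ℝ, MemLp f (d : ℝ≥0∞) (volume.restrict (cube d)) ∧
    ∀ u : BV d, α u = ∫ x in cube d, f x * u.toL1 x}

/-- The space `SCH([0,1]^d)` of strong charge functionals: the closure, for the operator norm, of
the range of `T` in `BV([0,1]^d)^*`. -/
def SCH (d : ℕ) : Set (BV d →L[ℝ] ℝ) := closure (rangeT d)

/-! ### `BV`-sets and strong charges -/

/-- The `BV`-subsets of `[0,1]^d`: the (Lebesgue) measurable subsets of finite perimeter
`‖B‖ = ‖D 1_B‖(ℝ^d)`. -/
structure BVSet (d : ℕ) where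
  carrier : Set (Eucl d)
  subset_cube : carrier ⊆ cube d
  measurable : NullMeasurableSet carrier volume
  perimeter_lt_top : variation (carrier.indicator fun _ => (1 : ℝ)) < ⊤

lemma volume_cube_lt_top (d : ℕ) : volume (cube d) < ⊤ := by
  refine (Metric.isBounded_iff_subset_closedBall (0 : Eucl d)).2 ⟨√d, fun x hx => ?_⟩
    |>.measure_lt_top
  rw [mem_closedBall_zero_iff, EuclideanSpace.norm_eq]
  refine Real.sqrt_le_sqrt ?_
  calc ∑ i, ‖x i‖ ^ 2 ≤ ∑ _i : Fin d, (1 : ℝ) := by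
        refine Finset.sum_le_sum fun i _ => ?_
        rw [Real.norm_eq_abs, sq_abs]
        nlinarith [(hx i).1, (hx i).2]
    _ = d := by simp

namespace BVSet

variable {d : ℕ}

lemma integrable_indicator (B : BVSet d) :
    Integrable (B.carrier.indicator fun _ => (1 : ℝ)) (volume : Measure (Eucl d)) := by
  refine IntegrableOn.integrable_indicator₀ ?_ B.measurable
  exact integrableOn_const
    (((measure_mono B.subset_cube).trans_lt (volume_cube_lt_top d)).ne) (by simp)

/-- The indicator function `1_B` as an element of `BV([0,1]^d)`. -/
def ind (B : BVSet d) : BV d :=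
  ⟨B.integrable_indicator.toL1 _, by
    have h := B.integrable_indicator.coeFn_toL1
    refine ⟨?_, ?_⟩
    · filter_upwards [h] with x hx hxc
      rw [hx]
      exact Set.indicator_of_notMem (fun hB => hxc (B.subset_cube hB)) _
    · rw [variation_congr h]
      exact B.perimeter_lt_top⟩

end BVSet

/-- A strong charge: a function on the `BV`-subsets of `[0,1]^d` of the form `B ↦ α(1_B)` with
`α ∈ SCH([0,1]^d)`. (Such a function is finitely additive and continuous with respect to
`BV`-convergence, i.e. it is a charge.) -/
def IsStrongCharge {d : ℕ} (μ : BVSet d → ℝ) : Prop :=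
  ∃ α ∈ SCH d, ∀ B : BVSet d, μ B = α B.ind

/-! ### Increments and strong chargeability -/

/-- `C₀([0,1]^d)`: the continuous functions on `[0,1]^d` that vanish at the points having at least
one zero coordinate. -/
def C0 (d : ℕ) : Type :=
  {f : C(Fin d → unitInterval, ℝ) // ∀ x : Fin d → unitInterval, (∃ i, x i = 0) → f x = 0}

instance {d : ℕ} : CoeFun (C0 d) (fun _ => (Fin d → unitInterval) → ℝ) := ⟨fun f => f.1⟩

/-- A rectangle `∏ [a_i, b_i] ⊆ [0,1]^d` with nonempty interior. -/
structure Rect (d : ℕ) where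
  a : Fin d → unitInterval
  b : Fin d → unitInterval
  lt : ∀ i, a i < b i

/-- The rectangle as a subset of `ℝ^d`. -/
def Rect.toSet {d : ℕ} (K : Rect d) : Set (Eucl d) :=
  {x | ∀ i, (K.a i : ℝ) ≤ x i ∧ x i ≤ (K.b i : ℝ)}

/-- The increment `Δ_f(K)`: the sum over the vertices `c ∈ ∏ {a_i, b_i}` of
`(-1)^{#{i : c_i = a_i}} f(c)`. The vertices are indexed by the set `s = {i : c_i = a_i}`. -/
def increment {d : ℕ} (f : C0 d) (K : Rect d) : ℝ :=
  ∑ s : Finset (Fin d), (-1 : ℝ) ^ s.card * f (fun i => if i ∈ s then K.a i else K.b i)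

/-- `μ` extends `Δ_f`, where `Δ_f` is extended from rectangles to figures by finite additivity: if a
figure `F` is the union of finitely many pairwise almost disjoint rectangles `K_1, …, K_n`, then
`Δ_f(F) = ∑ Δ_f(K_j)`. (Every figure is such a union, and is a `BV`-set.) -/
def ExtendsIncrement {d : ℕ} (f : C0 d) (μ : BVSet d → ℝ) : Prop :=
  ∀ (n : ℕ) (K : Fin n → Rect d),
    (∀ i j, i ≠ j → volume ((K i).toSet ∩ (K j).toSet) = 0) →
    ∀ F : BVSet d, F.carrier = ⋃ j, (K j).toSet → μ F = ∑ j, increment f (K j)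

/-- `f ∈ C₀([0,1]^d)` is strongly chargeable if `Δ_f` extends to a strong charge. -/
def StronglyChargeable {d : ℕ} (f : C0 d) : Prop :=
  ∃ μ : BVSet d → ℝ, IsStrongCharge μ ∧ ExtendsIncrement f μ

/-! ### The Brownian sheet -/

/-- `W` is a (standard) Brownian sheet on `[0,1]^d` with sample paths in `C₀([0,1]^d)`: a centered
Gaussian process with covariance `E(W_s W_t) = ∏ min(s_i, t_i)`. -/
structure IsBrownianSheet {Ω : Type*} [MeasurableSpace Ω] {d : ℕ} (W : Ω → C0 d)
    (P : Measure Ω) : Prop where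
  isGaussianProcess : IsGaussianProcess (fun (t : Fin d → unitInterval) (ω : Ω) => W ω t) P
  centered : ∀ t : Fin d → unitInterval, ∫ ω, W ω t ∂P = 0
  covariance : ∀ s t : Fin d → unitInterval,
    ∫ ω, W ω s * W ω t ∂P = ∏ i, min (s i : ℝ) (t i : ℝ)

end BrownianSheet

end

/-!
Fix `N` and cut `[0,1]^d` into the `N^d` cubes of side `1 / N`; let `V_N` be the sum of `|Δ_W(K)|`
over these cubes `K`.

If a path is strongly chargeable, then `V_N = o(N)` along it: up to an error `ε ‖1_K‖_BV`, the
increment over `K` is at most the integral over `K` of a fixed integrable function, and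
`∑ ‖1_K‖_BV ≤ 1 + 2 d N`, since a cube of side `1 / N` has perimeter `2 d (1 / N)^(d - 1)`.

The increments over almost disjoint rectangles are independent and centered Gaussian, with the
volumes of the rectangles as variances. Hence `V_N` has mean `c √(N^d)`, where `c` is the first
absolute moment of the standard Gaussian law, and variance at most `1`. As `∑ N^(-d) < ∞`, almost
surely `V_N / √(N^d) → c ≠ 0`. Since `N ≤ √(N^d)` for `d ≥ 2`, this excludes `V_N = o(N)`.
-/

noncomputable section

namespace BrownianSheet

open Filter Asymptotics
open scoped Topology Function

/-! ### Geometry of rectangles -/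

namespace Rect

section Volume

variable {d : ℕ}

lemma toSet_eq_preimage (K : Rect d) :
    K.toSet = WithLp.ofLp ⁻¹' Set.Icc (fun i => (K.a i : ℝ)) (fun i => (K.b i : ℝ)) := by
  ext x
  simp [toSet, Set.mem_Icc, Pi.le_def, forall_and]

lemma measurableSet_toSet (K : Rect d) : MeasurableSet K.toSet := by
  rw [K.toSet_eq_preimage]
  exact (PiLp.volume_preserving_ofLp (Fin d)).measurable measurableSet_Icc

lemma toSet_subset_cube (K : Rect d) : K.toSet ⊆ cube d := fun _ hx i =>
  ⟨(K.a i).2.1.trans (hx i).1, (hx i).2.trans (K.b i).2.2⟩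

lemma volume_real_inter (K L : Rect d) :
    volume.real (K.toSet ∩ L.toSet) =
      ∏ i, max (min (K.b i : ℝ) (L.b i) - max (K.a i : ℝ) (L.a i)) 0 := by
  rw [K.toSet_eq_preimage, L.toSet_eq_preimage, ← Set.preimage_inter, Set.Icc_inter_Icc,
    measureReal_def, (PiLp.volume_preserving_ofLp (Fin d)).measure_preimage
      measurableSet_Icc.nullMeasurableSet, Real.volume_Icc_pi, ENNReal.toReal_prod]
  simp only [ENNReal.toReal_ofReal', Pi.sup_apply, Pi.inf_apply]

lemma volume_real_toSet (K : Rect d) : volume.real K.toSet = ∏ i, ((K.b i : ℝ) - K.a i) := by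
  rw [← Set.inter_self K.toSet, volume_real_inter]
  refine Finset.prod_congr rfl fun i _ => ?_
  rw [min_self, max_self, max_eq_left (sub_nonneg.2 (show (K.a i : ℝ) ≤ K.b i from (K.lt i).le))]

end Volume

section Perimeter

variable {n : ℕ}

/-- The projection along the `i`-th axis of the two faces of a rectangle that are orthogonal to
this axis, as a subset of `ℝ^n`. -/
def face (K : Rect (n + 1)) (i : Fin (n + 1)) : Set (Fin n → ℝ) :=
  Set.Icc (fun j => (K.a (i.succAbove j) : ℝ)) (fun j => (K.b (i.succAbove j) : ℝ))

lemma volume_real_face (K : Rect (n + 1)) (i : Fin (n + 1)) :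
    volume.real (K.face i) = ∏ j, ((K.b (i.succAbove j) : ℝ) - K.a (i.succAbove j)) :=
  Real.volume_Icc_pi_toReal fun j => (K.lt (i.succAbove j)).le

lemma setIntegral_diverg (K : Rect (n + 1)) {v : Eucl (n + 1) → Eucl (n + 1)}
    (hv : ContDiff ℝ 1 v) :
    ∫ x in K.toSet, diverg v x = ∑ i,
      ((∫ y in K.face i, v (WithLp.toLp 2 (i.insertNth (K.b i : ℝ) y)) i) -
        ∫ y in K.face i, v (WithLp.toLp 2 (i.insertNth (K.a i : ℝ) y)) i) := by
  let e := PiLp.continuousLinearEquiv 2 ℝ (fun _ : Fin (n + 1) => ℝ)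
  have hcont : Continuous v := hv.continuous
  have hcomp (y : Fin (n + 1) → ℝ) : HasFDerivAt (fun y => e (v (e.symm y)))
      ((e : Eucl (n + 1) →L[ℝ] Fin (n + 1) → ℝ) ∘L fderiv ℝ v (e.symm y) ∘L
        (e.symm : (Fin (n + 1) → ℝ) →L[ℝ] Eucl (n + 1))) y :=
    e.hasFDerivAt.comp y
      ((hv.differentiable one_ne_zero _).hasFDerivAt.comp y e.symm.hasFDerivAt)
  have hdiverg : Continuous fun y => diverg v (e.symm y) := by
    have := hv.continuous_fderiv one_ne_zero
    unfold diverg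
    fun_prop
  have htoLp : MeasurableEmbedding (@WithLp.toLp 2 (Fin (n + 1) → ℝ)) :=
    (MeasurableEquiv.toLp 2 _).measurableEmbedding
  rw [← (PiLp.volume_preserving_toLp (Fin (n + 1))).setIntegral_preimage_emb htoLp,
    K.toSet_eq_preimage]
  exact integral_divergence_of_hasFDerivAt_off_countable (fun i => (K.a i : ℝ))
    (fun i => (K.b i : ℝ)) (fun i => (K.lt i).le) _ _ ∅ Set.countable_empty (by fun_prop)
    (fun y _ => hcomp y) hdiverg.integrableOn_Icc

lemma setIntegral_diverg_le (K : Rect (n + 1)) {v : Eucl (n + 1) → Eucl (n + 1)}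
    (hv : v ∈ testFields (n + 1)) :
    ∫ x in K.toSet, diverg v x ≤ 2 * ∑ i, volume.real (K.face i) := by
  have hflux (i : Fin (n + 1)) (t : ℝ) :
      |∫ y in K.face i, v (WithLp.toLp 2 (i.insertNth t y)) i| ≤ volume.real (K.face i) := by
    have hle (y : Fin n → ℝ) : ‖v (WithLp.toLp 2 (i.insertNth t y)) i‖ ≤ 1 :=
      (PiLp.norm_apply_le _ i).trans (hv.2.2 _)
    have hnorm := norm_setIntegral_le_of_norm_le_const (s := K.face i) (μ := volume)
      isCompact_Icc.measure_lt_top fun y _ => hle y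
    rwa [one_mul, Real.norm_eq_abs] at hnorm
  rw [K.setIntegral_diverg hv.1, Finset.mul_sum]
  refine Finset.sum_le_sum fun i _ => ?_
  linarith [le_of_abs_le (hflux i (K.b i)), neg_le_of_abs_le (hflux i (K.a i))]

lemma variation_indicator_le (K : Rect (n + 1)) :
    variation (K.toSet.indicator fun _ => (1 : ℝ)) ≤
      ENNReal.ofReal (2 * ∑ i, volume.real (K.face i)) := by
  refine iSup₂_le fun v hv => ENNReal.ofReal_le_ofReal ?_
  simp only [← Set.indicator_mul_left, one_mul, integral_indicator K.measurableSet_toSet]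
  exact K.setIntegral_diverg_le hv

/-- A rectangle as a `BV`-set. -/
def toBVSet (K : Rect (n + 1)) : BVSet (n + 1) where
  carrier := K.toSet
  subset_cube := K.toSet_subset_cube
  measurable := K.measurableSet_toSet.nullMeasurableSet
  perimeter_lt_top := K.variation_indicator_le.trans_lt ENNReal.ofReal_lt_top

end Perimeter

end Rect

namespace BVSet

variable {d : ℕ}

lemma coeFn_ind (B : BVSet d) : ⇑B.ind.toL1 =ᵐ[volume] B.carrier.indicator fun _ => (1 : ℝ) :=
  B.integrable_indicator.coeFn_toL1

lemma norm_ind (B : BVSet d) :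
    ‖B.ind‖ = volume.real B.carrier +
      (variation (B.carrier.indicator fun _ => (1 : ℝ))).toReal := by
  have hnorm : (fun x => ‖B.ind.toL1 x‖) =ᵐ[volume] B.carrier.indicator fun _ => (1 : ℝ) := by
    filter_upwards [B.coeFn_ind] with x hx
    rw [hx, norm_indicator_eq_indicator_norm, norm_one]
  rw [BV.norm_def, variation_congr B.coeFn_ind, L1.norm_eq_integral_norm,
    integral_congr_ae hnorm, integral_indicator₀ B.measurable, setIntegral_const, smul_eq_mul,
    mul_one]

lemma setIntegral_cube_mul_ind (B : BVSet d) (g : Eucl d → ℝ) :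
    ∫ x in cube d, g x * B.ind.toL1 x = ∫ x in B.carrier, g x := by
  have hB : NullMeasurableSet B.carrier (volume.restrict (cube d)) :=
    B.measurable.mono Measure.restrict_le_self
  have hind : (fun x => g x * B.ind.toL1 x) =ᵐ[volume.restrict (cube d)]
      B.carrier.indicator g := by
    filter_upwards [ae_restrict_of_ae B.coeFn_ind] with x hx
    rw [hx, ← Set.indicator_mul_right]
    simp only [mul_one]
  rw [integral_congr_ae hind, integral_indicator₀ hB, Measure.restrict_restrict₀ hB,
    Set.inter_eq_left.2 B.subset_cube]

end BVSet

lemma Rect.norm_ind_le {n : ℕ} (K : Rect (n + 1)) :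
    ‖K.toBVSet.ind‖ ≤ volume.real K.toSet + 2 * ∑ i, volume.real (K.face i) := by
  rw [BVSet.norm_ind]
  exact add_le_add le_rfl
    (ENNReal.toReal_le_of_le_ofReal (by positivity) K.variation_indicator_le)

/-! ### Strong charges on almost disjoint rectangles -/

lemma sum_setIntegral_le_of_aedisjoint {X ι : Type*} [MeasurableSpace X] [Fintype ι]
    {μ : Measure X} {g : X → ℝ} {s : Set X} {t : ι → Set X} (hg : IntegrableOn g s μ)
    (hg0 : ∀ x, 0 ≤ g x) (ht : ∀ i, NullMeasurableSet (t i) μ) (hts : ∀ i, t i ⊆ s)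
    (hd : Pairwise (AEDisjoint μ on t)) : ∑ i, ∫ x in t i, g x ∂μ ≤ ∫ x in s, g x ∂μ := by
  have hsub : ⋃ i, t i ⊆ s := Set.iUnion_subset hts
  have hsum := hasSum_integral_iUnion_ae ht hd (hg.mono_set hsub)
  rw [(hasSum_fintype _).unique hsum]
  exact setIntegral_mono_set hg (.of_forall hg0) hsub.eventuallyLE

lemma exists_abs_apply_ind_le_of_mem_SCH {d : ℕ} [NeZero d] {α : BV d →L[ℝ] ℝ} (hα : α ∈ SCH d)
    {ε : ℝ} (hε : 0 < ε) : ∃ g : Eucl d → ℝ, IntegrableOn g (cube d) ∧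
      ∀ B : BVSet d, |α B.ind| ≤ ε * ‖B.ind‖ + ∫ x in B.carrier, |g x| := by
  obtain ⟨β, ⟨g, hg, hβ⟩, hαβ⟩ := Metric.mem_closure_iff.1 hα ε hε
  have : IsFiniteMeasure (volume.restrict (cube d)) :=
    isFiniteMeasure_restrict.2 (volume_cube_lt_top d).ne
  refine ⟨g, hg.integrable (by exact_mod_cast NeZero.one_le), fun B => ?_⟩
  have hsub : |(α - β) B.ind| ≤ ε * ‖B.ind‖ := by
    refine ((α - β).le_opNorm _).trans ?_
    gcongr
    exact (dist_eq_norm α β ▸ hαβ).le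
  have hmain : |β B.ind| ≤ ∫ x in B.carrier, |g x| := by
    rw [hβ, B.setIntegral_cube_mul_ind]
    exact abs_integral_le_integral_abs
  calc |α B.ind| = |(α - β) B.ind + β B.ind| := by simp
    _ ≤ ε * ‖B.ind‖ + ∫ x in B.carrier, |g x| := (abs_add_le _ _).trans (add_le_add hsub hmain)

section Chargeable

variable {n : ℕ} {f : C0 (n + 1)}

lemma ExtendsIncrement.apply_toBVSet {μ : BVSet (n + 1) → ℝ} (h : ExtendsIncrement f μ)
    (K : Rect (n + 1)) : μ K.toBVSet = increment f K := by
  simpa using h 1 (fun _ => K) (fun i j hij => (hij (Subsingleton.elim i j)).elim) K.toBVSet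
    (Set.iUnion_const K.toSet).symm

lemma StronglyChargeable.exists_sum_abs_increment_le (hf : StronglyChargeable f) {ε : ℝ}
    (hε : 0 < ε) : ∃ C : ℝ, ∀ (ι : Type) [Fintype ι] (K : ι → Rect (n + 1)),
      Pairwise (AEDisjoint volume on fun j => (K j).toSet) →
        ∑ j, |increment f (K j)| ≤ ε * ∑ j, ‖(K j).toBVSet.ind‖ + C := by
  obtain ⟨μ, ⟨α, hα, hμα⟩, hμ⟩ := hf
  obtain ⟨g, hg, hαg⟩ := exists_abs_apply_ind_le_of_mem_SCH hα hε
  refine ⟨∫ x in cube (n + 1), |g x|, fun ι _ K hK => ?_⟩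
  calc ∑ j, |increment f (K j)|
      ≤ ∑ j, (ε * ‖(K j).toBVSet.ind‖ + ∫ x in (K j).toSet, |g x|) := by
        gcongr with j
        rw [← hμ.apply_toBVSet, hμα]
        exact hαg _
    _ = ε * ∑ j, ‖(K j).toBVSet.ind‖ + ∑ j, ∫ x in (K j).toSet, |g x| := by
        rw [Finset.sum_add_distrib, Finset.mul_sum]
    _ ≤ ε * ∑ j, ‖(K j).toBVSet.ind‖ + ∫ x in cube (n + 1), |g x| := by
        gcongr
        exact sum_setIntegral_le_of_aedisjoint hg.abs (fun x => abs_nonneg _)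
          (fun j => (K j).measurableSet_toSet.nullMeasurableSet)
          (fun j => (K j).toSet_subset_cube) hK

end Chargeable

/-! ### The regular grid -/

section Grid

variable {d n N : ℕ}

/-- The cube `∏ [k_i / N, (k_i + 1) / N]` of the regular grid with mesh `1 / N`. -/
def gridCell (k : Fin d → Fin N) : Rect d where
  a i := ⟨(k i : ℝ) / N, by positivity, div_le_one_of_le₀ (by exact_mod_cast (k i).2.le)
    (by positivity)⟩
  b i := ⟨((k i : ℝ) + 1) / N, by positivity, div_le_one_of_le₀ (by exact_mod_cast (k i).2)
    (by positivity)⟩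
  lt i := by
    have : (0 : ℝ) < N := by exact_mod_cast (k i).pos
    refine Subtype.mk_lt_mk.2 ?_
    gcongr
    exact lt_add_one _

lemma gridCell_b_sub_a (k : Fin d → Fin N) (i : Fin d) :
    ((gridCell k).b i : ℝ) - (gridCell k).a i = (N : ℝ)⁻¹ := by
  simp only [gridCell]
  ring

lemma gridCell_b_le_a {k l : Fin d → Fin N} {i : Fin d} (h : k i < l i) :
    ((gridCell k).b i : ℝ) ≤ (gridCell l).a i := by
  simp only [gridCell]
  gcongr
  exact_mod_cast h

lemma volume_real_gridCell (k : Fin d → Fin N) :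
    volume.real (gridCell k).toSet = (N : ℝ)⁻¹ ^ d := by
  simp [Rect.volume_real_toSet, gridCell_b_sub_a]

lemma volume_real_face_gridCell (k : Fin (n + 1) → Fin N) (i : Fin (n + 1)) :
    volume.real ((gridCell k).face i) = (N : ℝ)⁻¹ ^ n := by
  simp [Rect.volume_real_face, gridCell_b_sub_a]

lemma pairwise_aedisjoint_gridCell (d N : ℕ) :
    Pairwise (AEDisjoint volume on fun k : Fin d → Fin N => (gridCell k).toSet) := by
  intro k l hkl
  wlog h : ∃ i, k i < l i generalizing k l
  · obtain ⟨i, hi⟩ := Function.ne_iff.1 hkl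
    exact (this hkl.symm ⟨i, (not_lt.1 fun hlt => h ⟨i, hlt⟩).lt_of_ne hi.symm⟩).symm
  obtain ⟨i, hi⟩ := h
  have hfin : volume ((gridCell k).toSet ∩ (gridCell l).toSet) ≠ ⊤ :=
    measure_ne_top_of_subset (Set.inter_subset_left.trans (gridCell k).toSet_subset_cube)
      (volume_cube_lt_top d).ne
  refine (measureReal_eq_zero_iff hfin).1 ?_
  rw [Rect.volume_real_inter]
  refine Finset.prod_eq_zero (Finset.mem_univ i) (max_eq_right (sub_nonpos.2 ?_))
  exact (min_le_left _ _).trans ((gridCell_b_le_a hi).trans (le_max_right _ _))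

lemma sum_norm_ind_gridCell_le (n N : ℕ) :
    ∑ k : Fin (n + 1) → Fin N, ‖(gridCell k).toBVSet.ind‖ ≤ 1 + 2 * (n + 1) * N := by
  rcases N.eq_zero_or_pos with rfl | hN
  · simp
  calc ∑ k : Fin (n + 1) → Fin N, ‖(gridCell k).toBVSet.ind‖
      ≤ ∑ _k : Fin (n + 1) → Fin N, ((N : ℝ)⁻¹ ^ (n + 1) + 2 * (n + 1) * (N : ℝ)⁻¹ ^ n) := by
        gcongr with k
        refine (gridCell k).norm_ind_le.trans_eq ?_
        simp [volume_real_gridCell, volume_real_face_gridCell, mul_assoc]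
    _ = (N : ℝ) ^ (n + 1) * ((N : ℝ)⁻¹ ^ (n + 1) + 2 * (n + 1) * (N : ℝ)⁻¹ ^ n) := by
        simp [mul_add]
    _ = 1 + 2 * (n + 1) * N := by
        rw [inv_pow, inv_pow, pow_succ (N : ℝ)]
        field_simp

/-- The sum of the absolute increments of `f` over the `N^d` cells of the regular grid with mesh
`1 / N`. -/
def gridVariation (f : C0 d) (N : ℕ) : ℝ :=
  ∑ k : Fin d → Fin N, |increment f (gridCell k)|

lemma StronglyChargeable.gridVariation_isLittleO {f : C0 (n + 1)} (hf : StronglyChargeable f) :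
    gridVariation f =o[atTop] fun N : ℕ => (N : ℝ) := by
  refine isLittleO_iff.2 fun c hc => ?_
  obtain ⟨C, hC⟩ := hf.exists_sum_abs_increment_le (ε := c / (4 * (n + 1))) (by positivity)
  have hlarge : ∀ᶠ N : ℕ in atTop, c / (4 * (n + 1)) + C ≤ c / 2 * N :=
    (tendsto_natCast_atTop_atTop.const_mul_atTop (half_pos hc)).eventually_ge_atTop _
  filter_upwards [hlarge] with N hN
  have hnonneg : 0 ≤ gridVariation f N := Finset.sum_nonneg fun k _ => abs_nonneg _
  rw [Real.norm_of_nonneg hnonneg, Real.norm_natCast]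
  calc gridVariation f N
      ≤ c / (4 * (n + 1)) * ∑ k : Fin (n + 1) → Fin N, ‖(gridCell k).toBVSet.ind‖ + C :=
        hC _ _ (pairwise_aedisjoint_gridCell _ _)
    _ ≤ c / (4 * (n + 1)) * (1 + 2 * (n + 1) * N) + C := by
        gcongr
        exact sum_norm_ind_gridCell_le n N
    _ = c / (4 * (n + 1)) + C + c / 2 * N := by
        field_simp
        ring
    _ ≤ c * N := by linarith

end Grid

/-! ### Increments of the Brownian sheet -/

lemma sum_neg_one_pow_card_mul_prod_ite {ι R : Type*} [Fintype ι] [DecidableEq ι] [CommRing R]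
    (x y : ι → R) :
    ∑ s : Finset ι, (-1) ^ s.card * ∏ i, (if i ∈ s then x i else y i) = ∏ i, (y i - x i) := by
  rw [Finset.prod_sub, Finset.powerset_univ]
  refine Finset.sum_congr rfl fun s _ => ?_
  rw [Finset.prod_ite, mul_assoc, mul_comm (∏ i ∈ Finset.univ \ s, y i)]
  congr 3 <;> ext i <;> simp

/-- Both sides are the length of `[a, b] ∩ [c, d]`. -/
lemma min_sub_min_sub_min_sub_min {a b c d : ℝ} (hab : a ≤ b) (hcd : c ≤ d) :
    (min b d - min b c) - (min a d - min a c) = max (min b d - max a c) 0 := by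
  grind

section Moments

variable {Ω : Type*} [MeasurableSpace Ω] {P : Measure Ω}

lemma ae_tendsto_sub_integral_of_tsum_evariance_ne_top {X : ℕ → Ω → ℝ}
    (hX : ∀ n, AEMeasurable (X n) P) (hsum : ∑' n, eVar[X n; P] ≠ ∞) :
    ∀ᵐ ω ∂P, Tendsto (fun n => X n ω - ∫ ω', X n ω' ∂P) atTop (𝓝 0) := by
  have hmeas (n : ℕ) : AEMeasurable (fun ω => ‖X n ω - ∫ ω', X n ω' ∂P‖ₑ ^ 2) P :=
    ((hX n).sub_const _).enorm.pow_const 2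
  have hfin : ∫⁻ ω, ∑' n, ‖X n ω - ∫ ω', X n ω' ∂P‖ₑ ^ 2 ∂P ≠ ∞ := by
    rwa [lintegral_tsum hmeas]
  filter_upwards [ae_lt_top' (AEMeasurable.tsum hmeas) hfin] with ω hω
  have hsq := ENNReal.tendsto_atTop_zero_of_tsum_ne_top hω.ne
  rw [tendsto_zero_iff_enorm_tendsto_zero]
  simpa [ENNReal.pow_rpow_inv_natCast, -Nat.cast_ofNat] using
    hsq.ennrpow_const ((2 : ℕ) : ℝ)⁻¹

/-- The first absolute moment of the standard Gaussian law. -/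
def gaussianAbsMoment : ℝ := ∫ x, |x| ∂(gaussianReal 0 1)

lemma gaussianAbsMoment_pos : 0 < gaussianAbsMoment := by
  have hint : Integrable (fun x : ℝ => |x|) (gaussianReal 0 1) :=
    ((memLp_id_gaussianReal 1).integrable (by simp)).abs
  have hsupp : Function.support (fun x : ℝ => |x|) = {0}ᶜ := by
    ext x
    simp
  have := nullSingletonClass_gaussianReal (μ := 0) (v := 1) one_ne_zero
  rw [gaussianAbsMoment, integral_pos_iff_support_of_nonneg (fun x => abs_nonneg x) hint, hsupp,
    (prob_compl_eq_one_iff (measurableSet_singleton 0)).2 (measure_singleton 0)]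
  exact one_pos

lemma integral_abs_of_hasGaussianLaw {X : Ω → ℝ} (hX : HasGaussianLaw X P)
    (hX0 : ∫ ω, X ω ∂P = 0) :
    ∫ ω, |X ω| ∂P = √(Var[X; P]) * gaussianAbsMoment := by
  have hmap : P.map X = (gaussianReal 0 1).map (√(Var[X; P]) * ·) := by
    rw [hX.map_eq_gaussianReal, gaussianReal_map_const_mul, hX0, mul_zero, mul_one]
    congr 1
    ext
    simp [Real.sq_sqrt, variance_nonneg X P]
  calc ∫ ω, |X ω| ∂P = ∫ x, |x| ∂(P.map X) :=
        (integral_map hX.aemeasurable (by fun_prop)).symm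
    _ = ∫ x, |√(Var[X; P]) * x| ∂(gaussianReal 0 1) := by
        rw [hmap, integral_map (by fun_prop) (by fun_prop)]
    _ = √(Var[X; P]) * gaussianAbsMoment := by
        simp_rw [abs_mul, abs_of_nonneg (Real.sqrt_nonneg _)]
        rw [integral_const_mul, gaussianAbsMoment]

end Moments

namespace IsBrownianSheet

variable {Ω : Type*} [MeasurableSpace Ω] {P : Measure Ω} {d : ℕ} {W : Ω → C0 d}

lemma isGaussianProcess_increment (hW : IsBrownianSheet W P) :
    IsGaussianProcess (fun (K : Rect d) ω => increment (W ω) K) P := by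
  classical
  refine hW.isGaussianProcess.of_isGaussianProcess fun K => ?_
  let vertex : Finset (Fin d) → Fin d → unitInterval := fun s i => if i ∈ s then K.a i else K.b i
  have hvertex (s) : vertex s ∈ Finset.univ.image vertex :=
    Finset.mem_image_of_mem vertex (Finset.mem_univ s)
  refine ⟨Finset.univ.image vertex, ∑ s : Finset (Fin d), ((-1 : ℝ) ^ s.card) •
    ContinuousLinearMap.proj (R := ℝ) (φ := fun _ => ℝ) ⟨vertex s, hvertex s⟩, fun ω => ?_⟩
  simp [increment, vertex]

lemma memLp_two (hW : IsBrownianSheet W P) (t : Fin d → unitInterval) :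
    MemLp (fun ω => W ω t) 2 P :=
  (hW.isGaussianProcess.hasGaussianLaw_eval t).memLp_two

lemma memLp_two_increment (hW : IsBrownianSheet W P) (K : Rect d) :
    MemLp (fun ω => increment (W ω) K) 2 P :=
  (hW.isGaussianProcess_increment.hasGaussianLaw_eval K).memLp_two

lemma memLp_two_abs_increment (hW : IsBrownianSheet W P) (K : Rect d) :
    MemLp (fun ω => |increment (W ω) K|) 2 P :=
  (hW.memLp_two_increment K).abs

lemma integral_increment (hW : IsBrownianSheet W P) (K : Rect d) :
    ∫ ω, increment (W ω) K ∂P = 0 := by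
  simp only [increment]
  rw [integral_finsetSum _ fun s _ =>
    ((hW.isGaussianProcess.hasGaussianLaw_eval _).integrable.const_mul _)]
  simp [integral_const_mul, hW.centered]

lemma memLp_two_gridVariation (hW : IsBrownianSheet W P) (N : ℕ) :
    MemLp (fun ω => gridVariation (W ω) N) 2 P :=
  memLp_finsetSum _ fun k _ => hW.memLp_two_abs_increment (gridCell k)

variable [IsProbabilityMeasure P]

lemma covariance_eval (hW : IsBrownianSheet W P) (s t : Fin d → unitInterval) :
    cov[fun ω => W ω s, fun ω => W ω t; P] = ∏ i, min (s i : ℝ) (t i : ℝ) := by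
  rw [covariance_eq_sub (hW.memLp_two s) (hW.memLp_two t), hW.centered, zero_mul, sub_zero,
    ← hW.covariance s t]
  rfl

lemma covariance_eval_increment (hW : IsBrownianSheet W P) (t : Fin d → unitInterval)
    (K : Rect d) :
    cov[fun ω => W ω t, fun ω => increment (W ω) K; P] =
      ∏ i, (min (t i : ℝ) (K.b i) - min (t i : ℝ) (K.a i)) := by
  simp only [increment]
  rw [covariance_fun_sum_right (fun s => (hW.memLp_two _).const_mul _) (hW.memLp_two t),
    ← sum_neg_one_pow_card_mul_prod_ite]
  refine Finset.sum_congr rfl fun s _ => ?_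
  rw [covariance_const_mul_right, hW.covariance_eval]
  congr 2 with i
  split_ifs <;> rfl

lemma covariance_increment (hW : IsBrownianSheet W P) (K L : Rect d) :
    cov[fun ω => increment (W ω) K, fun ω => increment (W ω) L; P] =
      volume.real (K.toSet ∩ L.toSet) := by
  have hK : (fun ω => increment (W ω) K) = fun ω => ∑ s : Finset (Fin d), (-1 : ℝ) ^ s.card *
      W ω (fun i => if i ∈ s then K.a i else K.b i) := rfl
  rw [Rect.volume_real_inter, hK, covariance_fun_sum_left
    (fun s => (hW.memLp_two _).const_mul _) (hW.memLp_two_increment L)]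
  simp only [← min_sub_min_sub_min_sub_min (K.lt _).le (L.lt _).le]
  rw [← sum_neg_one_pow_card_mul_prod_ite]
  refine Finset.sum_congr rfl fun s _ => ?_
  rw [covariance_const_mul_left, hW.covariance_eval_increment]
  congr 2 with i
  split_ifs <;> rfl

lemma variance_increment (hW : IsBrownianSheet W P) (K : Rect d) :
    Var[fun ω => increment (W ω) K; P] = volume.real K.toSet := by
  rw [← covariance_self (hW.memLp_two_increment K).aemeasurable, hW.covariance_increment,
    Set.inter_self]

lemma indepFun_increment (hW : IsBrownianSheet W P) {K L : Rect d}
    (hKL : AEDisjoint volume K.toSet L.toSet) :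
    IndepFun (fun ω => increment (W ω) K) (fun ω => increment (W ω) L) P := by
  refine hW.isGaussianProcess_increment.hasGaussianLaw_prodMk.indepFun_of_covariance_eq_zero ?_
  rw [hW.covariance_increment, measureReal_def, hKL, ENNReal.toReal_zero]

lemma integral_abs_increment (hW : IsBrownianSheet W P) (K : Rect d) :
    ∫ ω, |increment (W ω) K| ∂P = √(volume.real K.toSet) * gaussianAbsMoment := by
  rw [integral_abs_of_hasGaussianLaw (hW.isGaussianProcess_increment.hasGaussianLaw_eval K)
    (hW.integral_increment K), hW.variance_increment]

lemma variance_abs_increment_le (hW : IsBrownianSheet W P) (K : Rect d) :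
    Var[fun ω => |increment (W ω) K|; P] ≤ volume.real K.toSet := by
  refine (variance_le_expectation_sq
    (hW.memLp_two_abs_increment K).aestronglyMeasurable).trans_eq ?_
  rw [← hW.variance_increment, variance_of_integral_eq_zero
    (hW.memLp_two_increment K).aemeasurable (hW.integral_increment K)]
  simp only [Pi.pow_apply, sq_abs]

lemma variance_sum_abs_increment_le (hW : IsBrownianSheet W P) {ι : Type*} [Fintype ι]
    {K : ι → Rect d} (hK : Pairwise (AEDisjoint volume on fun j => (K j).toSet)) :
    Var[fun ω => ∑ j, |increment (W ω) (K j)|; P] ≤ ∑ j, volume.real (K j).toSet := by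
  rw [← Finset.sum_fn, IndepFun.variance_sum (fun j _ => hW.memLp_two_abs_increment (K j))
    (fun i _ j _ hij => (hW.indepFun_increment (hK hij)).comp measurable_abs measurable_abs)]
  exact Finset.sum_le_sum fun j _ => hW.variance_abs_increment_le (K j)

lemma integral_gridVariation (hW : IsBrownianSheet W P) (N : ℕ) :
    ∫ ω, gridVariation (W ω) N ∂P = √((N : ℝ) ^ d) * gaussianAbsMoment := by
  simp only [gridVariation]
  rw [integral_finsetSum _ fun k _ =>
    (hW.memLp_two_abs_increment (gridCell k)).integrable one_le_two]
  calc ∑ k : Fin d → Fin N, ∫ ω, |increment (W ω) (gridCell k)| ∂P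
      = (N : ℝ) ^ d * (√((N : ℝ)⁻¹ ^ d) * gaussianAbsMoment) := by
        simp [hW.integral_abs_increment, volume_real_gridCell]
    _ = √((N : ℝ) ^ d) * gaussianAbsMoment := by
        rw [← mul_assoc, inv_pow, Real.sqrt_inv, ← div_eq_mul_inv, Real.div_sqrt]

lemma variance_gridVariation_le (hW : IsBrownianSheet W P) (N : ℕ) :
    Var[fun ω => gridVariation (W ω) N; P] ≤ 1 := by
  calc Var[fun ω => gridVariation (W ω) N; P]
      ≤ ∑ k : Fin d → Fin N, volume.real (gridCell k).toSet :=
        hW.variance_sum_abs_increment_le (pairwise_aedisjoint_gridCell d N)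
    _ = ((N : ℝ) * (N : ℝ)⁻¹) ^ d := by simp [volume_real_gridCell, mul_pow]
    _ ≤ 1 := pow_le_one₀ (by positivity) mul_inv_le_one

lemma ae_tendsto_gridVariation_div_sqrt (hW : IsBrownianSheet W P) (hd : 2 ≤ d) :
    ∀ᵐ ω ∂P, Tendsto (fun N : ℕ => gridVariation (W ω) N / √((N : ℝ) ^ d)) atTop
      (𝓝 gaussianAbsMoment) := by
  have hmem (N : ℕ) : MemLp (fun ω => gridVariation (W ω) N / √((N : ℝ) ^ d)) 2 P := by
    simpa only [div_eq_mul_inv] using (hW.memLp_two_gridVariation N).mul_const _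
  have hmean : ∀ᶠ N : ℕ in atTop,
      ∫ ω, gridVariation (W ω) N / √((N : ℝ) ^ d) ∂P = gaussianAbsMoment := by
    filter_upwards [eventually_gt_atTop 0] with N hN
    rw [integral_div, hW.integral_gridVariation, mul_div_cancel_left₀ _ (by positivity)]
  have hvar (N : ℕ) :
      Var[fun ω => gridVariation (W ω) N / √((N : ℝ) ^ d); P] ≤ 1 / (N : ℝ) ^ d := by
    simp only [div_eq_mul_inv]
    rw [variance_mul_const, inv_pow, Real.sq_sqrt (by positivity)]
    gcongr
    exact hW.variance_gridVariation_le N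
  have hsum : ∑' N : ℕ, eVar[fun ω => gridVariation (W ω) N / √((N : ℝ) ^ d); P] ≠ ∞ := by
    refine ne_top_of_le_ne_top (Real.summable_one_div_nat_pow.2 hd).tsum_ofReal_ne_top
      (ENNReal.tsum_le_tsum fun N => ?_)
    rw [← ofReal_variance (hmem N)]
    exact ENNReal.ofReal_le_ofReal (hvar N)
  filter_upwards [ae_tendsto_sub_integral_of_tsum_evariance_ne_top
    (fun N => (hmem N).aemeasurable) hsum] with ω hω
  simpa using hω.add (tendsto_const_nhds.congr' (hmean.mono fun N hN => hN.symm))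

end IsBrownianSheet

lemma natCast_isBigO_sqrt_pow {d : ℕ} (hd : 2 ≤ d) :
    (fun N : ℕ => (N : ℝ)) =O[atTop] fun N : ℕ => √((N : ℝ) ^ d) := by
  refine IsBigO.of_bound 1 ?_
  filter_upwards [eventually_ge_atTop 1] with N hN
  rw [one_mul, Real.norm_natCast, Real.norm_of_nonneg (Real.sqrt_nonneg _)]
  exact Real.le_sqrt_of_sq_le (pow_le_pow_right₀ (by exact_mod_cast hN) hd)

end BrownianSheet

end

theorem mainTheorem3 {Ω : Type*} [MeasurableSpace Ω] (P : MeasureTheory.Measure Ω)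
    [MeasureTheory.IsProbabilityMeasure P] (d : ℕ) (hd : 2 ≤ d)
    (W : Ω → BrownianSheet.C0 d) (hW : BrownianSheet.IsBrownianSheet W P) :
    ∀ᵐ ω ∂P, ¬ BrownianSheet.StronglyChargeable (W ω) := by
  filter_upwards [hW.ae_tendsto_gridVariation_div_sqrt hd] with ω hlim hcharge
  obtain ⟨n, rfl⟩ : ∃ n, d = n + 1 := Nat.exists_eq_succ_of_ne_zero (by positivity)
  have hzero := (hcharge.gridVariation_isLittleO.trans_isBigO
    (BrownianSheet.natCast_isBigO_sqrt_pow hd)).tendsto_div_nhds_zero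
  exact BrownianSheet.gaussianAbsMoment_pos.ne' (tendsto_nhds_unique hlim hzero)
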